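/- Let $X$ be a geodesic metric space (any two points $x,y$ are joined by a path of length $d(x,y)$), let $\bullet\in X$ be a basepoint, let $G$ be an Abelian group, let $s>0$, and let $S\subset X$ be a subset containing $\bullet$ that is $s$-dense (for every $x\in X$ there is $y\in S$ with $d(x,y)<s$), with the restricted metric. For $r>0$ let $\operatorname{Rips}(Y,r)$ be the open Rips complex of a metric space $Y$, whose simplices are the nonempty finite $\sigma\subset Y$ with $\operatorname{Diam}(\sigma)<r$. For $p\le q$ let $i^{\pi_1,Y}_{p,q}\colon\pi_1(\operatorname{Rips}(Y,p),\bullet)\to\pi_1(\operatorname{Rips}(Y,q),\bullet)$ and $i^{G,Y}_{p,q}\colon H_1(\operatorname{Rips}(Y,p);G)\to H_1(\operatorname{Rips}(Y,q);G)$ be the bonding maps induced by inclusion; these groups and maps (for all $r>0$) form the $\pi_1$-persistence and the $H_1(\_;G)$-persistence of $Y$. Let $\mu_r^{\pi_1,S}\colon\pi_1(\operatorname{Rips}(S,r),\bullet)\to\pi_1(\operatorname{Rips}(X,r),\bullet)$ and $\mu_r^{G,S}\colon H_1(\operatorname{Rips}(S,r);G)\to H_1(\operatorname{Rips}(X,r);G)$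 be induced by $S\hookrightarrow X$. A number $c>0$ is a critical value of a persistence with bonding maps $i$ if $i_{c-\varepsilon,c}$ is not an isomorphism for all small enough $\varepsilon>0$, or $i_{c,c+\varepsilon}$ is not an isomorphism for all $\varepsilon>0$. (1) Suppose $p>0$, $q\ge0$ and the $\pi_1$-persistence (respectively the $H_1(\_;G)$-persistence) of $X$ has no critical values on $(p,p+2s+q]$. Then: (a) $\mu_r^{\pi_1,S}$ (respectively $\mu_r^{G,S}$) is an isomorphism for every $r\in(p+2s,p+2s+q]$; (b) $i^{\pi_1,S}_{p',q'}$ (respectively $i^{G,S}_{p',q'}$) is an isomorphism for all $p'\le q'$ with $[p',q']\subseteq(p+2s,p+2s+q]$. (2) Suppose moreover that $X$ is compact. Let $C$ be the set of critical values of the $\pi_1$-persistence of $X$ and put $\mathcal J=[2s,\infty)\setminus\bigcup_{c\in C}(c,c+2s)$. Then there is an isomorphism of persistences $$\{\pi_1(\operatorname{Rips}(X,r),\bullet)\}_{r\in\mathcal J}\cong\{\pi_1(\operatorname{Rips}(S,r),\bullet)\}_{r\in\mathcal J},$$ that is, a family of group isomorphisms, one for each $r\in\mathcal J$, commuting with all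 bonding maps between parameters in $\mathcal J$. Likewise, with $C$ replaced by the set of critical values of the $H_1(\_;G)$-persistence of $X$ in the definition of $\mathcal J$, $\{H_1(\operatorname{Rips}(X,r);G)\}_{r\in\mathcal J}\cong\{H_1(\operatorname{Rips}(S,r);G)\}_{r\in\mathcal J}$. -/

import Mathlib

open CategoryTheory

universe u v w

namespace RipsPersistence

/-! ### Simplicial maps -/

open scoped Classical in
/-- A simplicial map: a map of vertices that sends simplices to simplices. -/
structure SimplicialMap {V : Type u} {W : Type v} (K : AbstractSimplicialComplex V)
    (L : AbstractSimplicialComplex W) where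
  toFun : V → W
  image_mem : ∀ t : Finset V, t ∈ K → t.image toFun ∈ L

/-- The vertices `a`, `b` span a simplex of `K` (an edge, or a vertex if `a = b`). -/
def IsEdge {V : Type u} (K : AbstractSimplicialComplex V) (a b : V) : Prop :=
  open scoped Classical in ({a, b} : Finset V) ∈ K

/-- The vertices `a`, `b`, `c` span a simplex of `K` (repetitions are allowed). -/
def IsTriangle {V : Type u} (K : AbstractSimplicialComplex V) (a b c : V) : Prop :=
  open scoped Classical in ({a, b, c} : Finset V) ∈ K

section Basic

variable {V : Type u} {W : Type v} {U : Type w} {K : AbstractSimplicialComplex V}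
  {L : AbstractSimplicialComplex W} {M : AbstractSimplicialComplex U}

def SimplicialMap.comp (g : SimplicialMap L M) (f : SimplicialMap K L) : SimplicialMap K M where
  toFun := g.toFun ∘ f.toFun
  image_mem t ht := by
    classical
    have h := g.image_mem _ (f.image_mem t ht)
    rw [Finset.image_image] at h
    convert h

theorem IsEdge.refl (a : V) : IsEdge K a a := by
  classical
  unfold IsEdge
  convert (show ({a} : Finset V) ∈ K from K.singleton_mem a) using 1
  ext x
  simp

theorem IsEdge.symm {a b : V} (h : IsEdge K a b) : IsEdge K b a := by
  unfold IsEdge at *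
  convert h using 1
  ext x
  simp only [Finset.mem_insert, Finset.mem_singleton]
  tauto

theorem IsEdge.triangle_back {a b : V} (h : IsEdge K a b) : IsTriangle K b a b := by
  unfold IsEdge IsTriangle at *
  convert h using 1
  ext x
  simp only [Finset.mem_insert, Finset.mem_singleton]
  tauto

theorem IsEdge.map (f : SimplicialMap K L) {a b : V} (h : IsEdge K a b) :
    IsEdge L (f.toFun a) (f.toFun b) := by
  have h' := f.image_mem _ h
  simpa [IsEdge, Finset.image_insert] using h'

theorem IsTriangle.map (f : SimplicialMap K L) {a b c : V} (h : IsTriangle K a b c) :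
    IsTriangle L (f.toFun a) (f.toFun b) (f.toFun c) := by
  have h' := f.image_mem _ h
  simpa [IsTriangle, Finset.image_insert] using h'

theorem IsTriangle.edge {a b c x y : V} (h : IsTriangle K a b c)
    (hx : x = a ∨ x = b ∨ x = c) (hy : y = a ∨ y = b ∨ y = c) : IsEdge K x y := by
  classical
  refine (K.isRelLowerSet_faces h).2 ?_ ⟨x, by simp⟩
  intro z hz
  simp only [Finset.mem_insert, Finset.mem_singleton] at hz ⊢
  rcases hz with rfl | rfl <;> assumption

end Basic

/-! ### The fundamental group of a simplicial complex (edge-path group) -/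

/-- Edge paths in `K` from one vertex to another: finite sequences of vertices, each consecutive
pair of which spans a simplex of `K`. -/
inductive EdgePath {V : Type u} (K : AbstractSimplicialComplex V) : V → V → Type u
  | nil (a : V) : EdgePath K a a
  | cons {a b c : V} (h : IsEdge K a b) (p : EdgePath K b c) : EdgePath K a c

namespace EdgePath

variable {V : Type u} {W : Type v} {U : Type w} {K : AbstractSimplicialComplex V}
  {L : AbstractSimplicialComplex W} {M : AbstractSimplicialComplex U}

/-- The path along one edge. -/
def single {a b : V} (h : IsEdge K a b) : EdgePath K a b := cons h (nil b)

/-- Concatenation. -/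
def comp : {a b c : V} → EdgePath K a b → EdgePath K b c → EdgePath K a c
  | _, _, _, nil _, q => q
  | _, _, _, cons h p, q => cons h (comp p q)

/-- The reversed path. -/
def reverse : {a b : V} → EdgePath K a b → EdgePath K b a
  | _, _, nil a => nil a
  | _, _, cons h p => comp (reverse p) (single h.symm)

/-- The image of an edge path under a simplicial map. -/
def map (f : SimplicialMap K L) : {a b : V} → EdgePath K a b →
    EdgePath L (f.toFun a) (f.toFun b)
  | _, _, nil a => nil (f.toFun a)
  | _, _, cons h p => cons (h.map f) (map f p)

/-- Simplicial homotopy of edge paths relative to the end points: the smallest equivalence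
relation compatible with concatenation for which a constant edge is trivial and two sides of a
(possibly degenerate) triangle may be replaced by the third. -/
inductive Homotopic : {a b : V} → EdgePath K a b → EdgePath K a b → Prop
  | refl {a b : V} (p : EdgePath K a b) : Homotopic p p
  | symm {a b : V} {p q : EdgePath K a b} : Homotopic p q → Homotopic q p
  | trans {a b : V} {p q r : EdgePath K a b} : Homotopic p q → Homotopic q r → Homotopic p r
  | comp {a b c : V} {p p' : EdgePath K a b} {q q' : EdgePath K b c} :
      Homotopic p p' → Homotopic q q' → Homotopic (p.comp q) (p'.comp q')
  | const {a : V} (h : IsEdge K a a) : Homotopic (single h) (nil a)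
  | triangle {a b c : V} (h : IsTriangle K a b c) (hab : IsEdge K a b) (hbc : IsEdge K b c)
      (hac : IsEdge K a c) : Homotopic ((single hab).comp (single hbc)) (single hac)

@[simp] theorem nil_comp {a b : V} (p : EdgePath K a b) : (nil a).comp p = p := rfl

@[simp] theorem comp_nil {a b : V} (p : EdgePath K a b) : p.comp (nil b) = p := by
  induction p with
  | nil a => rfl
  | cons h p ih => simp [comp, ih]

theorem comp_assoc {a b c d : V} (p : EdgePath K a b) (q : EdgePath K b c)
    (r : EdgePath K c d) : (p.comp q).comp r = p.comp (q.comp r) := by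
  induction p with
  | nil a => rfl
  | cons h p ih => simp [comp, ih]

theorem map_comp_path (f : SimplicialMap K L) {a b c : V} (p : EdgePath K a b)
    (q : EdgePath K b c) : (p.comp q).map f = (p.map f).comp (q.map f) := by
  induction p with
  | nil a => rfl
  | cons h p ih => simp [comp, map, ih]

theorem map_map (g : SimplicialMap L M) (f : SimplicialMap K L) {a b : V} (p : EdgePath K a b) :
    (p.map f).map g = p.map (g.comp f) := by
  induction p with
  | nil a => rfl
  | cons h p ih => exact congrArg (cons _) ih

theorem Homotopic.map (f : SimplicialMap K L) {a b : V} {p q : EdgePath K a b}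
    (h : Homotopic p q) : Homotopic (p.map f) (q.map f) := by
  induction h with
  | refl p => exact .refl _
  | symm _ ih => exact ih.symm
  | trans _ _ ih₁ ih₂ => exact ih₁.trans ih₂
  | comp _ _ ih₁ ih₂ => rw [map_comp_path, map_comp_path]; exact ih₁.comp ih₂
  | const h => exact .const (h.map f)
  | triangle h hab hbc hac => exact .triangle (h.map f) (hab.map f) (hbc.map f) (hac.map f)

theorem single_comp_single_symm {a b : V} (h : IsEdge K a b) :
    Homotopic ((single h.symm).comp (single h)) (nil b) :=
  (Homotopic.triangle h.triangle_back h.symm h (IsEdge.refl b)).trans (.const _)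

theorem reverse_comp_self {a b : V} (p : EdgePath K a b) :
    Homotopic (p.reverse.comp p) (nil b) := by
  induction p with
  | nil a => exact .refl _
  | @cons a b c h p ih =>
    have e : (cons h p).reverse.comp (cons h p) =
        p.reverse.comp (((single h.symm).comp (single h)).comp p) := by
      simp [reverse, comp_assoc, single, comp]
    rw [e]
    exact ((Homotopic.refl _).comp
      ((single_comp_single_symm h).comp (.refl p))).trans (by simpa using ih)

theorem comp_reverse_self {a b : V} (p : EdgePath K a b) :
    Homotopic (p.comp p.reverse) (nil a) := by
  induction p with
  | nil a => exact .refl _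
  | @cons a b c h p ih =>
    have e : (cons h p).comp (cons h p).reverse =
        (single h).comp ((p.comp p.reverse).comp (single h.symm)) := by
      simp [reverse, comp_assoc, single, comp]
    rw [e]
    exact ((Homotopic.refl _).comp (ih.comp (.refl _))).trans (single_comp_single_symm h.symm)

theorem Homotopic.reverse {a b : V} {p q : EdgePath K a b} (h : Homotopic p q) :
    Homotopic p.reverse q.reverse := by
  have h₁ : Homotopic (p.reverse.comp (q.comp q.reverse)) p.reverse := by
    simpa using (Homotopic.refl p.reverse).comp (comp_reverse_self q)
  have h₂ : Homotopic (p.reverse.comp (q.comp q.reverse)) q.reverse := by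
    rw [← comp_assoc]
    have := (((Homotopic.refl p.reverse).comp h.symm).trans (reverse_comp_self p)).comp
      (.refl q.reverse)
    simpa using this
  exact h₁.symm.trans h₂

/-- Homotopy of edge loops based at `x`. -/
def loopSetoid (K : AbstractSimplicialComplex V) (x : V) : Setoid (EdgePath K x x) where
  r := Homotopic
  iseqv := ⟨.refl, .symm, .trans⟩

end EdgePath

/-- The fundamental group `π₁(K, x)` of a simplicial complex: homotopy classes of edge loops based
at the vertex `x`, with concatenation as the product. -/
def PiOne {V : Type u} (K : AbstractSimplicialComplex V) (x : V) : Type u :=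
  Quotient (EdgePath.loopSetoid K x)

namespace PiOne

variable {V : Type u} {W : Type v} {U : Type w} {K : AbstractSimplicialComplex V}
  {L : AbstractSimplicialComplex W} {M : AbstractSimplicialComplex U}

/-- The class of an edge loop. -/
def mk {x : V} (p : EdgePath K x x) : PiOne K x := Quotient.mk (EdgePath.loopSetoid K x) p

instance (x : V) : Group (PiOne K x) where
  mul := Quotient.map₂ EdgePath.comp fun _ _ h _ _ h' => EdgePath.Homotopic.comp h h'
  one := mk (EdgePath.nil x)
  inv := Quotient.map EdgePath.reverse fun _ _ h => EdgePath.Homotopic.reverse h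
  mul_assoc := by
    rintro ⟨p⟩ ⟨q⟩ ⟨r⟩
    exact congrArg mk (EdgePath.comp_assoc p q r)
  one_mul := by
    rintro ⟨p⟩
    rfl
  mul_one := by
    rintro ⟨p⟩
    exact congrArg mk (EdgePath.comp_nil p)
  inv_mul_cancel := by
    rintro ⟨p⟩
    exact Quotient.sound (s := EdgePath.loopSetoid K x) (EdgePath.reverse_comp_self p)

/-- The homomorphism of fundamental groups induced by a simplicial map. -/
def map (f : SimplicialMap K L) (x : V) : PiOne K x →* PiOne L (f.toFun x) where
  toFun := Quotient.map (EdgePath.map f) fun _ _ h => EdgePath.Homotopic.map f h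
  map_one' := rfl
  map_mul' := by
    rintro ⟨p⟩ ⟨q⟩
    exact congrArg mk (EdgePath.map_comp_path f p q)

theorem map_map (g : SimplicialMap L M) (f : SimplicialMap K L) (x : V) (z : PiOne K x) :
    map g (f.toFun x) (map f x z) = map (g.comp f) x z := by
  obtain ⟨p⟩ := z
  exact congrArg mk (EdgePath.map_map g f p)

end PiOne

/-! ### First homology of a simplicial complex -/

section Homology

variable {V : Type u} {W : Type v} (K : AbstractSimplicialComplex V)
  {L : AbstractSimplicialComplex W} (G : Type w) [AddCommGroup G]

/-- Ordered 1-simplices: pairs of vertices that span a simplex. -/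
def Edge : Type u := {e : V × V // IsEdge K e.1 e.2}

/-- Ordered 2-simplices: triples of vertices that span a simplex. -/
def Triangle : Type u := {t : V × V × V // IsTriangle K t.1 t.2.1 t.2.2}

variable {K}

/-- The face `(a, b)` of the ordered 2-simplex `(a, b, c)`. -/
def Triangle.face₂ (t : Triangle K) : Edge K :=
  ⟨(t.1.1, t.1.2.1), t.2.edge (by simp) (by simp)⟩

/-- The face `(a, c)` of the ordered 2-simplex `(a, b, c)`. -/
def Triangle.face₁ (t : Triangle K) : Edge K :=
  ⟨(t.1.1, t.1.2.2), t.2.edge (by simp) (by simp)⟩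

/-- The face `(b, c)` of the ordered 2-simplex `(a, b, c)`. -/
def Triangle.face₀ (t : Triangle K) : Edge K :=
  ⟨(t.1.2.1, t.1.2.2), t.2.edge (by simp) (by simp)⟩

variable (K)

/-- The boundary `C₁(K; G) → C₀(K; G)` of the ordered simplicial chain complex,
`g • (a, b) ↦ g • b - g • a`. -/
noncomputable def boundaryOne : (Edge K →₀ G) →+ (V →₀ G) :=
  Finsupp.liftAddHom fun e => Finsupp.singleAddHom e.1.2 - Finsupp.singleAddHom e.1.1

/-- The boundary `C₂(K; G) → C₁(K; G)` of the ordered simplicial chain complex,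
`g • (a, b, c) ↦ g • (b, c) - g • (a, c) + g • (a, b)`. -/
noncomputable def boundaryTwo : (Triangle K →₀ G) →+ (Edge K →₀ G) :=
  Finsupp.liftAddHom fun t => Finsupp.singleAddHom t.face₀ - Finsupp.singleAddHom t.face₁
    + Finsupp.singleAddHom t.face₂

theorem boundaryOne_single (e : Edge K) (g : G) :
    boundaryOne K G (Finsupp.single e g) = Finsupp.single e.1.2 g - Finsupp.single e.1.1 g :=
  Finsupp.liftAddHom_apply_single _ e g

theorem boundaryTwo_single (t : Triangle K) (g : G) :
    boundaryTwo K G (Finsupp.single t g) = Finsupp.single t.face₀ g - Finsupp.single t.face₁ g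
      + Finsupp.single t.face₂ g :=
  Finsupp.liftAddHom_apply_single _ t g

theorem boundaryOne_boundaryTwo (z : Triangle K →₀ G) :
    boundaryOne K G (boundaryTwo K G z) = 0 := by
  induction z using Finsupp.induction_linear with
  | zero => simp
  | add z z' h h' => simp [h, h']
  | single t g =>
    rw [boundaryTwo_single, map_add, map_sub, boundaryOne_single, boundaryOne_single,
      boundaryOne_single]
    simp only [Triangle.face₀, Triangle.face₁, Triangle.face₂]
    abel

/-- The first simplicial homology group `H₁(K; G)`: cycles modulo boundaries. -/
def HOne : Type (max u w) :=
  (boundaryOne K G).ker ⧸ (boundaryTwo K G).range.addSubgroupOf (boundaryOne K G).ker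

noncomputable instance : AddCommGroup (HOne K G) :=
  inferInstanceAs (AddCommGroup
    ((boundaryOne K G).ker ⧸ (boundaryTwo K G).range.addSubgroupOf (boundaryOne K G).ker))

variable {K}

def Edge.map (f : SimplicialMap K L) (e : Edge K) : Edge L :=
  ⟨(f.toFun e.1.1, f.toFun e.1.2), e.2.map f⟩

def Triangle.map (f : SimplicialMap K L) (t : Triangle K) : Triangle L :=
  ⟨(f.toFun t.1.1, f.toFun t.1.2.1, f.toFun t.1.2.2), t.2.map f⟩

/-- The map on 1-chains induced by a simplicial map. -/
noncomputable def chainMap (f : SimplicialMap K L) : (Edge K →₀ G) →+ (Edge L →₀ G) :=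
  Finsupp.mapDomain.addMonoidHom (Edge.map f)

theorem chainMap_single (f : SimplicialMap K L) (e : Edge K) (g : G) :
    chainMap G f (Finsupp.single e g) = Finsupp.single (e.map f) g :=
  Finsupp.mapDomain_single

theorem boundaryOne_chainMap (f : SimplicialMap K L) (z : Edge K →₀ G) :
    boundaryOne L G (chainMap G f z) = Finsupp.mapDomain f.toFun (boundaryOne K G z) := by
  induction z using Finsupp.induction_linear with
  | zero => simp
  | add z z' h h' => simp only [map_add, h, h', Finsupp.mapDomain_add]
  | single e g =>
    rw [chainMap_single, boundaryOne_single, boundaryOne_single, sub_eq_add_neg, sub_eq_add_neg,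
      ← Finsupp.single_neg, ← Finsupp.single_neg, Finsupp.mapDomain_add,
      Finsupp.mapDomain_single, Finsupp.mapDomain_single]
    rfl

theorem chainMap_boundaryTwo (f : SimplicialMap K L) (z : Triangle K →₀ G) :
    chainMap G f (boundaryTwo K G z) =
      boundaryTwo L G (Finsupp.mapDomain (Triangle.map f) z) := by
  induction z using Finsupp.induction_linear with
  | zero => simp
  | add z z' h h' => simp only [map_add, h, h', Finsupp.mapDomain_add]
  | single t g =>
    rw [Finsupp.mapDomain_single, boundaryTwo_single, boundaryTwo_single, map_add, map_sub,
      chainMap_single, chainMap_single, chainMap_single]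
    rfl

/-- The map on 1-cycles induced by a simplicial map. -/
noncomputable def cycleMap (f : SimplicialMap K L) :
    (boundaryOne K G).ker →+ (boundaryOne L G).ker :=
  ((chainMap G f).comp (boundaryOne K G).ker.subtype).codRestrict _ fun z => by
    have hz : boundaryOne K G z.1 = 0 := z.2
    have h := boundaryOne_chainMap G f z.1
    rw [hz, Finsupp.mapDomain_zero] at h
    exact h

/-- The homomorphism of first homology groups induced by a simplicial map. -/
noncomputable def HOne.map (f : SimplicialMap K L) : HOne K G →+ HOne L G :=
  QuotientAddGroup.map _ _ (cycleMap G f) (by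
    rintro ⟨z, hz⟩ ⟨t, ht⟩
    exact ⟨Finsupp.mapDomain (Triangle.map f) t, by
      rw [← chainMap_boundaryTwo, ht]; rfl⟩)

theorem HOne.map_map {U : Type*} {M : AbstractSimplicialComplex U} (g : SimplicialMap L M)
    (f : SimplicialMap K L) (z : HOne K G) :
    HOne.map G g (HOne.map G f z) = HOne.map G (g.comp f) z := by
  obtain ⟨z⟩ := z
  refine congrArg (QuotientAddGroup.mk (s := (boundaryTwo M G).range.addSubgroupOf _))
    (Subtype.ext ?_)
  exact (Finsupp.mapDomain_comp (f := Edge.map f) (g := Edge.map g) (v := z.1)).symm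

end Homology

/-! ### Geodesic spaces and Rips complexes -/

/-- A geodesic space: any two points are joined by a path whose length is their distance. -/
def IsGeodesicSpace (X : Type u) [MetricSpace X] : Prop :=
  ∀ x y : X, ∃ γ : Path x y, eVariationOn γ Set.univ = edist x y

/-- `S` is `s`-dense in `X`. -/
def IsDenseSample {X : Type u} [MetricSpace X] (s : ℝ) (S : Set X) : Prop :=
  ∀ x : X, ∃ y ∈ S, dist x y < s

/-- The open Rips complex of `X` at scale `r > 0`: its simplices are the nonempty finite subsets of
diameter less than `r`. -/
def rips (X : Type u) [MetricSpace X] (r : Set.Ioi (0 : ℝ)) : AbstractSimplicialComplex X where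
  faces := {t | t.Nonempty ∧ Metric.diam (t : Set X) < r}
  isRelLowerSet_faces := by
    intro t ht
    refine ⟨ht.1, fun t' ht' hne => ⟨hne, ?_⟩⟩
    exact (Metric.diam_mono (by exact_mod_cast ht') t.finite_toSet.isBounded).trans_lt ht.2
  singleton_mem x := ⟨Finset.singleton_nonempty x, by simpa using Set.mem_Ioi.mp r.2⟩

/-- The bonding map of the Rips filtration: the identity on vertices. -/
def ripsBonding (X : Type u) [MetricSpace X] {p q : Set.Ioi (0 : ℝ)} (h : p ≤ q) :
    SimplicialMap (rips X p) (rips X q) where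
  toFun := id
  image_mem t ht := by
    classical
    have e : t.image id = t := Finset.image_id
    convert (show t ∈ rips X q from ⟨ht.1, ht.2.trans_le h⟩)

theorem EdgePath.map_ripsBonding_self (X : Type u) [MetricSpace X] {r : Set.Ioi (0 : ℝ)}
    (h : r ≤ r) {a b : X} (p : EdgePath (rips X r) a b) : p.map (ripsBonding X h) = p := by
  induction p with
  | nil a => rfl
  | cons h p ih => exact congrArg (EdgePath.cons _) ih

theorem HOne.map_ripsBonding_self (X : Type u) [MetricSpace X] (G : Type w) [AddCommGroup G]
    {r : Set.Ioi (0 : ℝ)} (h : r ≤ r) (z : HOne (rips X r) G) :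
    HOne.map G (ripsBonding X h) z = z := by
  obtain ⟨z⟩ := z
  refine congrArg (QuotientAddGroup.mk (s := (boundaryTwo _ G).range.addSubgroupOf _))
    (Subtype.ext ?_)
  exact Finsupp.mapDomain_id

/-- The inclusion of the Rips complex of a subset `S` (with the restricted metric) into that
of `X`. -/
def ripsInclusion {X : Type u} [MetricSpace X] (S : Set X) (r : Set.Ioi (0 : ℝ)) :
    SimplicialMap (rips S r) (rips X r) where
  toFun := Subtype.val
  image_mem t ht := by
    classical
    refine ⟨ht.1.image _, ?_⟩
    have h := (isometry_subtype_coe (s := S)).diam_image (t : Set S)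
    rw [Finset.coe_image, h]
    exact ht.2

/-! ### Persistences -/

/-- The `π₁`-persistence `{π₁(Rips(X, r), x)}_{r > 0}` with its bonding maps. -/
def piOnePersistence (X : Type u) [MetricSpace X] (x : X) : Set.Ioi (0 : ℝ) ⥤ GrpCat.{u} where
  obj r := GrpCat.of (PiOne (rips X r) x)
  map f := GrpCat.ofHom (PiOne.map (ripsBonding X (leOfHom f)) x)
  map_id r := by
    ext z
    obtain ⟨p⟩ := z
    exact congrArg PiOne.mk (EdgePath.map_ripsBonding_self X _ p)
  map_comp f g := by
    ext z
    exact (PiOne.map_map (ripsBonding X (leOfHom g)) (ripsBonding X (leOfHom f)) x z).symm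

/-- The homomorphisms `μ_r : π₁(Rips(S, r), x) → π₁(Rips(X, r), x)` induced by inclusion. -/
def piOneMu {X : Type u} [MetricSpace X] (S : Set X) (x : X) (hx : x ∈ S) :
    piOnePersistence S ⟨x, hx⟩ ⟶ piOnePersistence X x where
  app r := GrpCat.ofHom (PiOne.map (ripsInclusion S r) ⟨x, hx⟩)
  naturality p q f := by
    ext z
    exact (PiOne.map_map (ripsInclusion S q) (ripsBonding S (leOfHom f)) ⟨x, hx⟩ z).trans
      (PiOne.map_map (ripsBonding X (leOfHom f)) (ripsInclusion S p) ⟨x, hx⟩ z).symm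

/-- The `H₁(_; G)`-persistence `{H₁(Rips(X, r); G)}_{r > 0}` with its bonding maps. -/
noncomputable def hOnePersistence (X : Type u) [MetricSpace X] (G : Type w) [AddCommGroup G] :
    Set.Ioi (0 : ℝ) ⥤ AddCommGrpCat.{max u w} where
  obj r := AddCommGrpCat.of (HOne (rips X r) G)
  map f := AddCommGrpCat.ofHom (HOne.map G (ripsBonding X (leOfHom f)))
  map_id r := by
    ext z
    exact HOne.map_ripsBonding_self X G _ z
  map_comp f g := by
    ext z
    exact (HOne.map_map G (ripsBonding X (leOfHom g)) (ripsBonding X (leOfHom f)) z).symm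

/-- The homomorphisms `μ_r : H₁(Rips(S, r); G) → H₁(Rips(X, r); G)` induced by inclusion. -/
noncomputable def hOneMu {X : Type u} [MetricSpace X] (S : Set X) (G : Type w) [AddCommGroup G] :
    hOnePersistence S G ⟶ hOnePersistence X G where
  app r := AddCommGrpCat.ofHom (HOne.map G (ripsInclusion S r))
  naturality p q f := by
    ext z
    exact (HOne.map_map G (ripsInclusion S q) (ripsBonding S (leOfHom f)) z).trans
      (HOne.map_map G (ripsBonding X (leOfHom f)) (ripsInclusion S p) z).symm

section Critical

variable {C : Type v} [Category.{w} C]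

/-- `p` is a left critical value of a persistence: for all small enough `ε > 0` the bonding map
from `p - ε` to `p` is not an isomorphism. -/
def IsLeftCritical (F : Set.Ioi (0 : ℝ) ⥤ C) (p : Set.Ioi (0 : ℝ)) : Prop :=
  ∃ δ : ℝ, 0 < δ ∧ ∀ (a : Set.Ioi (0 : ℝ)) (h : a < p), (p : ℝ) - δ < a →
    ¬ IsIso (F.map (homOfLE h.le))

/-- `p` is a right critical value of a persistence: for all `ε > 0` the bonding map from `p` to
`p + ε` is not an isomorphism. -/
def IsRightCritical (F : Set.Ioi (0 : ℝ) ⥤ C) (p : Set.Ioi (0 : ℝ)) : Prop :=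
  ∀ (b : Set.Ioi (0 : ℝ)) (h : p < b), ¬ IsIso (F.map (homOfLE h.le))

/-- Critical values of a persistence. -/
def IsCritical (F : Set.Ioi (0 : ℝ) ⥤ C) (p : Set.Ioi (0 : ℝ)) : Prop :=
  IsLeftCritical F p ∨ IsRightCritical F p

/-- The set `[2s, ∞) \ ⋃_c (c, c + 2s)`, the union over the critical values `c` of `F`. -/
def stableSet (F : Set.Ioi (0 : ℝ) ⥤ C) (s : ℝ) : Set (Set.Ioi (0 : ℝ)) :=
  {r | 2 * s ≤ (r : ℝ) ∧
    ∀ c : Set.Ioi (0 : ℝ), IsCritical F c → (r : ℝ) ∉ Set.Ioo (c : ℝ) ((c : ℝ) + 2 * s)}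

/-- The restriction `{F_r}_{r ∈ J}` of a persistence to a set `J` of parameters. -/
def restrict (J : Set (Set.Ioi (0 : ℝ))) (F : Set.Ioi (0 : ℝ) ⥤ C) : J ⥤ C :=
  (Subtype.mono_coe (fun r => r ∈ J)).functor ⋙ F

end Critical

end RipsPersistence

/-! In a geodesic space an edge of `Rips(X, r)` can be subdivided into a path of `Rips(X, t)`, for
any `t ≤ r`, whose first half stays within half the edge length of the start and whose second half
stays within half of the end (`IsGeodesicSpace.exists_halved`). Coning the halves off from the two
ends shows the path homotopic to the edge in `Rips(X, r)`, so all bonding maps of `X` are onto.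
Subdivision respects triangles, and so inverts the bonding map, as soon as the loop obtained by
subdividing a triangle is trivial in `Rips(X, t)`. It is trivial in `Rips(X, r)`, hence injectivity
of the bonding map suffices.

If `t + 2s ≤ r`, moving each vertex by less than `s` into `S` sends `Rips(X, t)` to `Rips(S, r)`.
Subdividing and then moving inverts the inclusion `Rips(S, r) → Rips(X, r)` on edges, and on
triangles too when the bonding map `t → r` is injective. So `μ_r` is an isomorphism whenever that
bonding map is (`piOne_ripsInclusion_bijective`, `hOne_ripsInclusion_bijective`).

Since bonding maps are epimorphisms, a supremum argument makes them isomorphisms over closed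
intervals free of critical values (`isIso_map_of_not_isCritical`). Part (1) takes `t = r - 2s` and
gets the maps of `S` from naturality of `μ`. In part (2) the right end `r` may be critical, which is
harmless because a triangle of an open Rips complex already lies at a smaller scale. The left end is
kept off the critical values by compactness, which makes `S` dense for some `s' < s`.

`EdgeInverse` packages the substitution of paths for edges so that one construction serves both `π₁`
and `H₁`. -/

namespace RipsPersistence

/-! ### Cancellation and substitution of edge paths -/

namespace EdgePath

variable {V : Type u} {W : Type v} {U : Type w} {K : AbstractSimplicialComplex V}
  {L : AbstractSimplicialComplex W} {M : AbstractSimplicialComplex U}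

theorem Homotopic.of_comp_left {a b c : V} (r : EdgePath K a b) {p q : EdgePath K b c}
    (h : Homotopic (r.comp p) (r.comp q)) : Homotopic p q := by
  have key (p : EdgePath K b c) : Homotopic (r.reverse.comp (r.comp p)) p := by
    rw [← comp_assoc]
    exact (reverse_comp_self r).comp (.refl p)
  exact (key p).symm.trans (((Homotopic.refl _).comp h).trans (key q))

theorem Homotopic.of_comp_right {a b c : V} (r : EdgePath K b c) {p q : EdgePath K a b}
    (h : Homotopic (p.comp r) (q.comp r)) : Homotopic p q := by
  have key (p : EdgePath K a b) : Homotopic ((p.comp r).comp r.reverse) p := by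
    rw [comp_assoc]
    simpa using (Homotopic.refl p).comp (comp_reverse_self r)
  exact (key p).symm.trans ((h.comp (.refl _)).trans (key q))

/-- The path obtained by substituting a path of `L` for each edge of a path in `K`. -/
def bind {f : V → W} (φ : ∀ a b, IsEdge K a b → EdgePath L (f a) (f b)) :
    {a b : V} → EdgePath K a b → EdgePath L (f a) (f b)
  | _, _, nil a => nil (f a)
  | _, _, cons h p => (φ _ _ h).comp (bind φ p)

section Bind

variable {f : V → W} (φ : ∀ a b, IsEdge K a b → EdgePath L (f a) (f b))

theorem bind_comp {a b c : V} (p : EdgePath K a b) (q : EdgePath K b c) :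
    (p.comp q).bind φ = (p.bind φ).comp (q.bind φ) := by
  induction p with
  | nil a => rfl
  | cons h p ih => simp [comp, bind, ih, comp_assoc]

theorem bind_single {a b : V} (h : IsEdge K a b) : (single h).bind φ = φ a b h :=
  comp_nil _

theorem map_bind (F : SimplicialMap L M) {a b : V} (p : EdgePath K a b) :
    (p.bind φ).map F = p.bind (f := F.toFun ∘ f) fun a b h => (φ a b h).map F := by
  induction p with
  | nil a => rfl
  | cons h p ih => simp [bind, map_comp_path, ih]

theorem bind_map {f : W → U} (φ : ∀ a b, IsEdge L a b → EdgePath M (f a) (f b))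
    (F : SimplicialMap K L) {a b : V} (p : EdgePath K a b) :
    (p.map F).bind φ = p.bind (f := f ∘ F.toFun) fun _ _ h => φ _ _ (h.map F) := by
  induction p with
  | nil a => rfl
  | cons h p ih => simp [bind, map, ih]

theorem Homotopic.bind (hφ : ∀ a b c (hab : IsEdge K a b) (hbc : IsEdge K b c)
      (hac : IsEdge K a c), IsTriangle K a b c →
      Homotopic ((φ a b hab).comp (φ b c hbc)) (φ a c hac))
    {a b : V} {p q : EdgePath K a b} (h : Homotopic p q) :
    Homotopic (p.bind φ) (q.bind φ) := by
  induction h with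
  | refl p => exact .refl _
  | symm _ ih => exact ih.symm
  | trans _ _ ih₁ ih₂ => exact ih₁.trans ih₂
  | comp _ _ ih₁ ih₂ => rw [bind_comp, bind_comp]; exact ih₁.comp ih₂
  -- The degenerate triangle `(a, a, a)` makes the loop `φ a a h` idempotent, and an idempotent in a
  -- groupoid is trivial.
  | @const a h =>
    rw [bind_single]
    refine Homotopic.of_comp_left (φ a a h) ?_
    simpa [EdgePath.bind] using hφ a a a h h h h.triangle_back
  | triangle h hab hbc hac =>
    rw [bind_comp, bind_single, bind_single, bind_single]
    exact hφ _ _ _ hab hbc hac h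

/-- A substitution of edges that is conjugate to the identity on edges is so on paths. -/
theorem bind_natural {g : V → V} (ψ : ∀ a b, IsEdge K a b → EdgePath K (g a) (g b))
    (c : ∀ a, EdgePath K a (g a))
    (hc : ∀ a b (h : IsEdge K a b), Homotopic ((c a).comp (ψ a b h)) ((single h).comp (c b)))
    {a b : V} (p : EdgePath K a b) :
    Homotopic ((c a).comp (p.bind ψ)) (p.comp (c b)) := by
  induction p with
  | nil a => simpa [bind] using Homotopic.refl (c a)
  | @cons a b d h p ih =>
    have h₁ := (hc a b h).comp (.refl (p.bind ψ))
    rw [comp_assoc, comp_assoc] at h₁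
    exact h₁.trans ((Homotopic.refl (single h)).comp ih)

end Bind

end EdgePath

namespace PiOne

variable {V : Type u} {W : Type v} {K : AbstractSimplicialComplex V}
  {L : AbstractSimplicialComplex W}

theorem mk_eq_mk {x : V} {p q : EdgePath K x x} :
    mk p = mk q ↔ EdgePath.Homotopic p q :=
  Quotient.eq (r := EdgePath.loopSetoid K x)

theorem map_injective_iff (F : SimplicialMap K L) (x : V) :
    Function.Injective (map F x) ↔ ∀ p : EdgePath K x x,
      EdgePath.Homotopic (p.map F) (.nil _) → EdgePath.Homotopic p (.nil x) := by
  rw [injective_iff_map_eq_one]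
  constructor
  · intro h p hp
    exact mk_eq_mk.1 (h (mk p) (mk_eq_mk.2 hp))
  · rintro h ⟨p⟩ hp
    exact mk_eq_mk.2 (h p (mk_eq_mk.1 hp))

/-- Injectivity on one fundamental group gives faithfulness on paths starting in the component. -/
theorem homotopic_of_map {F : SimplicialMap K L} {x : V}
    (hF : Function.Injective (map F x)) {a b : V} (e : EdgePath K x a) {p q : EdgePath K a b}
    (h : EdgePath.Homotopic (p.map F) (q.map F)) : EdgePath.Homotopic p q := by
  refine .of_comp_left e (.of_comp_right (e.comp q).reverse ?_)
  refine .trans ?_ (EdgePath.comp_reverse_self (e.comp q)).symm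
  refine (map_injective_iff F x).1 hF _ ?_
  refine .trans ?_ ((EdgePath.comp_reverse_self (e.comp q)).map F)
  simp only [EdgePath.map_comp_path]
  exact (((EdgePath.Homotopic.refl _).comp h).comp (.refl _))

end PiOne

/-! ### Chains of paths -/

section Chains

variable {V : Type u} {W : Type v} {U : Type w} {K : AbstractSimplicialComplex V}
  {L : AbstractSimplicialComplex W} {M : AbstractSimplicialComplex U}
  (G : Type*) [AddCommGroup G]

/-- The ordered 1-simplex `(a, b)`. -/
def IsEdge.toEdge {a b : V} (h : IsEdge K a b) : Edge K := ⟨(a, b), h⟩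

/-- The ordered 2-simplex `(a, b, c)`. -/
def IsTriangle.toTriangle {a b c : V} (h : IsTriangle K a b c) : Triangle K := ⟨(a, b, c), h⟩

/-- The 1-chain `g • p` of an edge path `p`. -/
noncomputable def EdgePath.chain : {a b : V} → EdgePath K a b → G →+ (Edge K →₀ G)
  | _, _, .nil _ => 0
  | _, _, .cons h p => Finsupp.singleAddHom h.toEdge + chain p

theorem EdgePath.chain_comp {a b c : V} (p : EdgePath K a b) (q : EdgePath K b c) :
    (p.comp q).chain G = p.chain G + q.chain G := by
  induction p with
  | nil a => simp [EdgePath.comp, EdgePath.chain]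
  | cons h p ih => simp [EdgePath.comp, EdgePath.chain, ih, add_assoc]

theorem EdgePath.chain_single {a b : V} (h : IsEdge K a b) (g : G) :
    (EdgePath.single h).chain G g = Finsupp.single h.toEdge g := by
  simp [EdgePath.single, EdgePath.chain]

theorem EdgePath.boundaryOne_chain {a b : V} (p : EdgePath K a b) (g : G) :
    boundaryOne K G (p.chain G g) = Finsupp.single b g - Finsupp.single a g := by
  induction p with
  | nil a => simp [EdgePath.chain]
  | cons h p ih =>
    rw [EdgePath.chain, AddMonoidHom.add_apply, map_add, ih, Finsupp.singleAddHom_apply,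
      boundaryOne_single]
    simp only [IsEdge.toEdge]
    abel

theorem EdgePath.chainMap_chain (F : SimplicialMap K L) {a b : V} (p : EdgePath K a b) (g : G) :
    chainMap G F (p.chain G g) = (p.map F).chain G g := by
  induction p with
  | nil a => simp [EdgePath.chain, EdgePath.map]
  | cons h p ih =>
    rw [EdgePath.map, EdgePath.chain, EdgePath.chain, AddMonoidHom.add_apply, map_add, ih,
      Finsupp.singleAddHom_apply, chainMap_single]
    rfl

/-- Each elementary homotopy is the boundary of one ordered triangle, a constant edge being the
boundary of `(a, a, a)`. Homotopies built for `π₁` can thus be reused for `H₁`. -/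
theorem EdgePath.Homotopic.chain_sub_mem {a b : V} {p q : EdgePath K a b}
    (h : EdgePath.Homotopic p q) (g : G) :
    p.chain G g - q.chain G g ∈ (boundaryTwo K G).range := by
  induction h with
  | refl p => simp
  | symm _ ih => simpa using neg_mem ih
  | trans _ _ ih₁ ih₂ => simpa using add_mem ih₁ ih₂
  | comp _ _ ih₁ ih₂ =>
    rw [EdgePath.chain_comp, EdgePath.chain_comp, AddMonoidHom.add_apply, AddMonoidHom.add_apply,
      add_sub_add_comm]
    exact add_mem ih₁ ih₂
  | @const a h =>
    refine ⟨Finsupp.single h.triangle_back.toTriangle g, ?_⟩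
    rw [boundaryTwo_single, EdgePath.chain_single]
    simp [EdgePath.chain, IsTriangle.toTriangle, IsEdge.toEdge, Triangle.face₀, Triangle.face₁,
      Triangle.face₂]
  | @triangle a b c h hab hbc hac =>
    refine ⟨Finsupp.single h.toTriangle g, ?_⟩
    rw [boundaryTwo_single, EdgePath.chain_comp, AddMonoidHom.add_apply, EdgePath.chain_single,
      EdgePath.chain_single, EdgePath.chain_single]
    simp only [IsTriangle.toTriangle, IsEdge.toEdge, Triangle.face₀, Triangle.face₁,
      Triangle.face₂]
    abel

/-- The map on 1-chains that substitutes a path for each edge. -/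
noncomputable def chainBind {f : V → W} (φ : ∀ a b, IsEdge K a b → EdgePath L (f a) (f b)) :
    (Edge K →₀ G) →+ (Edge L →₀ G) :=
  Finsupp.liftAddHom fun e => (φ e.1.1 e.1.2 e.2).chain G

section Bind

variable {f : V → W} (φ : ∀ a b, IsEdge K a b → EdgePath L (f a) (f b))

theorem chainBind_single (e : Edge K) (g : G) :
    chainBind G φ (Finsupp.single e g) = (φ e.1.1 e.1.2 e.2).chain G g :=
  Finsupp.liftAddHom_apply_single _ e g

theorem boundaryOne_chainBind (z : Edge K →₀ G) :
    boundaryOne L G (chainBind G φ z) = Finsupp.mapDomain f (boundaryOne K G z) := by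
  induction z using Finsupp.induction_linear with
  | zero => simp
  | add z z' h h' => simp only [map_add, h, h', Finsupp.mapDomain_add]
  | single e g =>
    rw [chainBind_single, EdgePath.boundaryOne_chain, boundaryOne_single, sub_eq_add_neg,
      sub_eq_add_neg, ← Finsupp.single_neg, ← Finsupp.single_neg, Finsupp.mapDomain_add,
      Finsupp.mapDomain_single, Finsupp.mapDomain_single]

theorem chainMap_chainBind (F : SimplicialMap L M) (z : Edge K →₀ G) :
    chainMap G F (chainBind G φ z) =
      chainBind G (f := F.toFun ∘ f) (fun a b h => (φ a b h).map F) z := by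
  induction z using Finsupp.induction_linear with
  | zero => simp
  | add z z' h h' => simp only [map_add, h, h']
  | single e g => rw [chainBind_single, chainBind_single, EdgePath.chainMap_chain]

theorem chainBind_chainMap {f : W → U} (φ : ∀ a b, IsEdge L a b → EdgePath M (f a) (f b))
    (F : SimplicialMap K L) (z : Edge K →₀ G) :
    chainBind G φ (chainMap G F z) =
      chainBind G (f := f ∘ F.toFun) (fun _ _ h => φ _ _ (h.map F)) z := by
  induction z using Finsupp.induction_linear with
  | zero => simp
  | add z z' h h' => simp only [map_add, h, h']
  | single e g =>
    rw [chainMap_single, chainBind_single, chainBind_single]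
    rfl

theorem chainBind_boundaryTwo_mem (hφ : ∀ a b c (hab : IsEdge K a b) (hbc : IsEdge K b c)
      (hac : IsEdge K a c), IsTriangle K a b c → ∀ g : G,
      ((φ a b hab).comp (φ b c hbc)).chain G g - (φ a c hac).chain G g
        ∈ (boundaryTwo L G).range) (t : Triangle K →₀ G) :
    chainBind G φ (boundaryTwo K G t) ∈ (boundaryTwo L G).range := by
  induction t using Finsupp.induction_linear with
  | zero => simp
  | add z z' h h' => rw [map_add, map_add]; exact add_mem h h'
  | single t g =>
    have h := hφ _ _ _ t.face₂.2 t.face₀.2 t.face₁.2 t.2 g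
    rw [EdgePath.chain_comp, AddMonoidHom.add_apply] at h
    rw [boundaryTwo_single, map_add, map_sub, chainBind_single, chainBind_single,
      chainBind_single]
    convert h using 1
    simp only [Triangle.face₀, Triangle.face₁, Triangle.face₂]
    abel

theorem chainBind_sub_mem {g : V → V} (ψ : ∀ a b, IsEdge K a b → EdgePath K (g a) (g b))
    (c : ∀ a, EdgePath K a (g a))
    (hc : ∀ a b (h : IsEdge K a b),
      EdgePath.Homotopic ((c a).comp (ψ a b h)) ((EdgePath.single h).comp (c b)))
    (z : Edge K →₀ G) (hz : boundaryOne K G z = 0) :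
    chainBind G ψ z - z ∈ (boundaryTwo K G).range := by
  -- The conjugating paths form a chain homotopy in degree 0. With the term `D (∂z)` included, the
  -- claim holds for all chains and can be checked on single edges.
  let D : (V →₀ G) →+ (Edge K →₀ G) := Finsupp.liftAddHom fun a => (c a).chain G
  suffices H : ∀ z, chainBind G ψ z - z - D (boundaryOne K G z) ∈ (boundaryTwo K G).range by
    simpa [hz] using H z
  intro z
  induction z using Finsupp.induction_linear with
  | zero => simp
  | add z z' h h' =>
    convert add_mem h h' using 1
    simp only [map_add]
    abel
  | single e k =>
    have hD (a : V) : D (Finsupp.single a k) = (c a).chain G k :=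
      Finsupp.liftAddHom_apply_single _ a k
    convert (hc _ _ e.2).chain_sub_mem G k using 1
    rw [boundaryOne_single, map_sub, hD, hD, chainBind_single, EdgePath.chain_comp,
      EdgePath.chain_comp, AddMonoidHom.add_apply, AddMonoidHom.add_apply, EdgePath.chain_single]
    change _ - Finsupp.single e k - _ = _ - (Finsupp.single e k + _)
    abel

end Bind

theorem HOne.map_injective_iff (F : SimplicialMap K L) :
    Function.Injective (HOne.map G F) ↔ ∀ z, boundaryOne K G z = 0 →
      chainMap G F z ∈ (boundaryTwo L G).range → z ∈ (boundaryTwo K G).range := by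
  rw [injective_iff_map_eq_zero]
  constructor
  · intro h z hz hF
    have := h (QuotientAddGroup.mk ⟨z, hz⟩)
      ((QuotientAddGroup.eq_zero_iff _).2 (AddSubgroup.mem_addSubgroupOf.2 hF))
    exact AddSubgroup.mem_addSubgroupOf.1 ((QuotientAddGroup.eq_zero_iff _).1 this)
  · rintro h ⟨z, hz⟩ hF
    exact (QuotientAddGroup.eq_zero_iff _).2 (AddSubgroup.mem_addSubgroupOf.2
      (h z hz (AddSubgroup.mem_addSubgroupOf.1 ((QuotientAddGroup.eq_zero_iff _).1 hF))))

theorem HOne.map_surjective (F : SimplicialMap K L)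
    (h : ∀ z, boundaryOne L G z = 0 → ∃ z', boundaryOne K G z' = 0 ∧
      chainMap G F z' - z ∈ (boundaryTwo L G).range) :
    Function.Surjective (HOne.map G F) := by
  rintro ⟨z, hz⟩
  obtain ⟨z', hz', hF⟩ := h z hz
  refine ⟨QuotientAddGroup.mk ⟨z', hz'⟩, ?_⟩
  refine QuotientAddGroup.eq.2 (AddSubgroup.mem_addSubgroupOf.2 ?_)
  convert neg_mem hF using 1
  exact (neg_add_eq_sub _ _).trans (neg_sub _ _).symm

end Chains

/-! ### Inverses of simplicial maps up to homotopy of edges -/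

/-- An inverse of a simplicial map on edges: a substitution of paths of `K` for edges of `L` such
that both composites are conjugate to the identity on edges. Nothing is required of triangles. -/
structure EdgeInverse {V : Type u} {W : Type v} {K : AbstractSimplicialComplex V}
    {L : AbstractSimplicialComplex W} (F : SimplicialMap K L) where
  vertex : W → V
  edge : ∀ a b, IsEdge L a b → EdgePath K (vertex a) (vertex b)
  unit : ∀ a, EdgePath K a (vertex (F.toFun a))
  unit_natural : ∀ a b (h : IsEdge K a b), EdgePath.Homotopic
    ((unit a).comp (edge _ _ (h.map F))) ((EdgePath.single h).comp (unit b))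
  counit : ∀ a, EdgePath L a (F.toFun (vertex a))
  counit_natural : ∀ a b (h : IsEdge L a b), EdgePath.Homotopic
    ((counit a).comp ((edge a b h).map F)) ((EdgePath.single h).comp (counit b))

namespace EdgeInverse

variable {V : Type u} {W : Type v} {K : AbstractSimplicialComplex V}
  {L : AbstractSimplicialComplex W} {F : SimplicialMap K L} (I : EdgeInverse F)

include I

/-- Naturality of `counit` alone exhibits every loop of `L` as conjugate to an image; no condition
on triangles enters because only a representative is transported, not a homotopy. -/
theorem piOne_surjective (x : V) : Function.Surjective (PiOne.map F x) := by
  let e := I.unit x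
  -- The counit at `F x` need not be homotopic to the image of the unit at `x`. Their discrepancy
  -- `u` is compensated by lifting `u * z * u⁻¹` in place of `z`.
  let u : PiOne L (F.toFun x) := PiOne.mk ((I.counit (F.toFun x)).comp (e.reverse.map F))
  intro z
  obtain ⟨p, hp⟩ : ∃ p : EdgePath L (F.toFun x) (F.toFun x), PiOne.mk p = u * z * u⁻¹ :=
    Quotient.exists_rep _
  refine ⟨PiOne.mk ((e.comp (p.bind I.edge)).comp e.reverse), ?_⟩
  refine mul_left_cancel (a := u) (.trans ?_ ((eq_mul_inv_iff_mul_eq.1 hp)))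
  refine PiOne.mk_eq_mk.2 ?_
  have h₁ := (EdgePath.reverse_comp_self e).map F
  rw [EdgePath.map_comp_path] at h₁
  have h₂ := EdgePath.bind_natural (g := F.toFun ∘ I.vertex)
    (fun a b h => (I.edge a b h).map F) I.counit I.counit_natural p
  rw [← EdgePath.map_bind] at h₂
  have h₃ := ((EdgePath.Homotopic.refl (I.counit (F.toFun x))).comp h₁).comp
    (.refl (((p.bind I.edge).map F).comp (e.reverse.map F)))
  have h₄ := h₂.comp (.refl (e.reverse.map F))
  simp only [EdgePath.map_comp_path, EdgePath.comp_assoc] at h₃ h₄ ⊢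
  exact h₃.trans h₄

/-- With triangles respected, a null-homotopy in `L` is pulled back along the substitution, and
`unit` conjugates the result to the original loop. -/
theorem piOne_injective (hI : ∀ a b c (hab : IsEdge L a b) (hbc : IsEdge L b c)
      (hac : IsEdge L a c), IsTriangle L a b c →
      EdgePath.Homotopic ((I.edge a b hab).comp (I.edge b c hbc)) (I.edge a c hac))
    (x : V) : Function.Injective (PiOne.map F x) := by
  refine (PiOne.map_injective_iff F x).2 fun p hp => ?_
  have h₁ := hp.bind I.edge hI
  rw [EdgePath.bind_map] at h₁
  have h₂ := EdgePath.bind_natural (g := I.vertex ∘ F.toFun)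
    (fun _ _ h => I.edge _ _ (h.map F)) I.unit I.unit_natural p
  refine .of_comp_right (I.unit x) (h₂.symm.trans ?_)
  exact ((EdgePath.Homotopic.refl _).comp h₁).trans (by
    simpa [EdgePath.bind] using EdgePath.Homotopic.refl (I.unit x))

variable (G : Type*) [AddCommGroup G]

theorem hOne_surjective : Function.Surjective (HOne.map G F) := by
  refine HOne.map_surjective G F fun z hz => ⟨chainBind G I.edge z, ?_, ?_⟩
  · rw [boundaryOne_chainBind, hz, Finsupp.mapDomain_zero]
  · rw [chainMap_chainBind]
    exact chainBind_sub_mem G (g := F.toFun ∘ I.vertex) _ I.counit I.counit_natural z hz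

theorem hOne_injective (hI : ∀ a b c (hab : IsEdge L a b) (hbc : IsEdge L b c)
      (hac : IsEdge L a c), IsTriangle L a b c → ∀ g : G,
      ((I.edge a b hab).comp (I.edge b c hbc)).chain G g - (I.edge a c hac).chain G g
        ∈ (boundaryTwo K G).range) :
    Function.Injective (HOne.map G F) := by
  refine (HOne.map_injective_iff G F).2 fun z hz hF => ?_
  obtain ⟨t, ht⟩ := hF
  have h₁ := chainBind_boundaryTwo_mem G I.edge hI t
  rw [ht, chainBind_chainMap] at h₁
  have h₂ := chainBind_sub_mem G (g := I.vertex ∘ F.toFun)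
    (fun _ _ h => I.edge _ _ (h.map F)) I.unit I.unit_natural z hz
  simpa using sub_mem h₁ h₂

end EdgeInverse

/-- Injectivity on first homology detects homologies between paths. -/
theorem HOne.chain_sub_mem_of_map {V : Type u} {W : Type v} {K : AbstractSimplicialComplex V}
    {L : AbstractSimplicialComplex W} {F : SimplicialMap K L} (G : Type*) [AddCommGroup G]
    (hF : Function.Injective (HOne.map G F)) {a b : V} {p q : EdgePath K a b}
    (h : EdgePath.Homotopic (p.map F) (q.map F)) (g : G) :
    p.chain G g - q.chain G g ∈ (boundaryTwo K G).range := by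
  refine (HOne.map_injective_iff G F).1 hF _ ?_ ?_
  · rw [map_sub, EdgePath.boundaryOne_chain, EdgePath.boundaryOne_chain, sub_self]
  · rw [map_sub, EdgePath.chainMap_chain, EdgePath.chainMap_chain]
    exact h.chain_sub_mem G g

end RipsPersistence

namespace RipsPersistence

/-! ### Geodesic subdivisions -/

section Rips

variable {X : Type u} [MetricSpace X]

theorem isEdge_rips {r : Set.Ioi (0 : ℝ)} {a b : X} : IsEdge (rips X r) a b ↔ dist a b < r := by
  classical
  change (({a, b} : Finset X).Nonempty ∧ Metric.diam (({a, b} : Finset X) : Set X) < r) ↔ _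
  simp [Metric.diam_pair]

theorem isTriangle_rips {r : Set.Ioi (0 : ℝ)} {a b c : X} :
    IsTriangle (rips X r) a b c ↔ dist a b < r ∧ dist a c < r ∧ dist b c < r := by
  classical
  change (({a, b, c} : Finset X).Nonempty ∧ Metric.diam (({a, b, c} : Finset X) : Set X) < r) ↔ _
  simp [Metric.diam_triple, and_assoc]

/-- The intermediate value theorem places a point of the geodesic at half the distance from `x`;
additivity of length bounds its distance to `y`. -/
theorem IsGeodesicSpace.exists_midpoint (hX : IsGeodesicSpace X) (x y : X) :
    ∃ m, dist x m = dist x y / 2 ∧ dist m y ≤ dist x y / 2 := by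
  obtain ⟨γ, hγ⟩ := hX x y
  have hc : Continuous fun t => dist x (γ t) := by fun_prop
  obtain ⟨t, ht⟩ : ∃ t, dist x (γ t) = dist x y / 2 := by
    have := mem_range_of_exists_le_of_exists_ge (c := dist x y / 2) hc
      ⟨0, by simp; positivity⟩ ⟨1, by simp⟩
    exact this
  refine ⟨γ t, ht, ?_⟩
  have h : edist x (γ t) + edist (γ t) y ≤ edist x y := by
    rw [← hγ]
    have h₀ := eVariationOn.edist_le γ (s := Set.univ ∩ Set.Icc 0 t) (x := 0) (y := t)
      ⟨trivial, le_rfl, t.2.1⟩ ⟨trivial, t.2.1, le_rfl⟩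
    have h₁ := eVariationOn.edist_le γ (s := Set.univ ∩ Set.Icc t 1) (x := t) (y := 1)
      ⟨trivial, le_rfl, t.2.2⟩ ⟨trivial, t.2.2, le_rfl⟩
    rw [γ.source] at h₀
    rw [γ.target] at h₁
    refine (add_le_add h₀ h₁).trans ?_
    rw [eVariationOn.Icc_add_Icc γ (s := Set.univ) (a := 0) (b := t) (c := 1) t.2.1 t.2.2 trivial]
    exact eVariationOn.mono γ Set.inter_subset_left
  rw [edist_dist, edist_dist, edist_dist, ← ENNReal.ofReal_add dist_nonneg dist_nonneg,
    ENNReal.ofReal_le_ofReal_iff dist_nonneg] at h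
  linarith

/-- All vertices of the path satisfy `P`. -/
def EdgePath.Within {V : Type u} {K : AbstractSimplicialComplex V} (P : V → Prop) :
    {a b : V} → EdgePath K a b → Prop
  | a, _, .nil _ => P a
  | a, _, .cons _ p => P a ∧ Within P p

namespace EdgePath

section Within

variable {V : Type u} {W : Type v} {K : AbstractSimplicialComplex V}
  {L : AbstractSimplicialComplex W} {P Q : V → Prop}

theorem Within.mono (h : ∀ a, P a → Q a) {a b : V} {p : EdgePath K a b} (hp : p.Within P) :
    p.Within Q := by
  induction p with
  | nil a => exact h _ hp
  | cons e p ih => exact ⟨h _ hp.1, ih hp.2⟩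

theorem Within.left {a b : V} {p : EdgePath K a b} (hp : p.Within P) : P a := by
  cases p with
  | nil a => exact hp
  | cons e p => exact hp.1

theorem Within.right {a b : V} {p : EdgePath K a b} (hp : p.Within P) : P b := by
  induction p with
  | nil a => exact hp
  | cons e p ih => exact ih hp.2

theorem Within.comp {a b c : V} {p : EdgePath K a b} {q : EdgePath K b c} (hp : p.Within P)
    (hq : q.Within P) : (p.comp q).Within P := by
  induction p with
  | nil a => exact hq
  | cons e p ih => exact ⟨hp.1, ih hp.2 hq⟩

theorem Within.map (F : SimplicialMap K L) {R : W → Prop} (h : ∀ a, P a → R (F.toFun a))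
    {a b : V} {p : EdgePath K a b} (hp : p.Within P) : (p.map F).Within R := by
  induction p with
  | nil a => exact h _ hp
  | cons e p ih => exact ⟨h _ hp.1, ih hp.2⟩

end Within

/-- The edges of `p` and the apex `o` span a fan of triangles, since a Rips complex only asks for
pairwise distances. -/
theorem cone_left {r : Set.Ioi (0 : ℝ)} {o a b : X} {p : EdgePath (rips X r) a b}
    (hp : p.Within fun w => dist o w < r) :
    Homotopic ((single (isEdge_rips.2 hp.left)).comp p) (single (isEdge_rips.2 hp.right)) := by
  induction p with
  | nil a => simpa using Homotopic.refl _
  | @cons a b c h p ih =>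
    have ht : IsTriangle (rips X r) o a b :=
      isTriangle_rips.2 ⟨hp.1, hp.2.left, isEdge_rips.1 h⟩
    have h₁ := (Homotopic.triangle ht (isEdge_rips.2 hp.1) h (isEdge_rips.2 hp.2.left)).comp
      (.refl p)
    exact h₁.trans (ih hp.2)

theorem cone_right {r : Set.Ioi (0 : ℝ)} {o a b : X} {p : EdgePath (rips X r) a b}
    (hp : p.Within fun w => dist w o < r) :
    Homotopic (p.comp (single (isEdge_rips.2 hp.right))) (single (isEdge_rips.2 hp.left)) := by
  induction p with
  | nil a => exact .refl _
  | @cons a b c h p ih =>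
    have ht : IsTriangle (rips X r) a b o :=
      isTriangle_rips.2 ⟨isEdge_rips.1 h, hp.1, hp.2.left⟩
    exact ((Homotopic.refl (single h)).comp (ih hp.2)).trans
      (.triangle ht h (isEdge_rips.2 hp.2.left) (isEdge_rips.2 hp.1))

/-- A path that is a geodesic subdivision in a weak sense: its first half stays within half the
distance from the first end, and its second half within half the distance from the last end. -/
def Halved {r : Set.Ioi (0 : ℝ)} {a b : X} (p : EdgePath (rips X r) a b) : Prop :=
  ∃ (m : X) (p₁ : EdgePath (rips X r) a m) (p₂ : EdgePath (rips X r) m b), p = p₁.comp p₂ ∧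
    p₁.Within (fun w => dist a w ≤ dist a b / 2) ∧ p₂.Within (fun w => dist w b ≤ dist a b / 2)

/-- A simplicial map that moves the points of a halved path little carries it, up to homotopy and
conjugation, to the edge between its ends. -/
theorem Halved.map_homotopic {Y : Type v} [MetricSpace Y] {t r : Set.Ioi (0 : ℝ)} {a b : X}
    {p : EdgePath (rips X t) a b} (hp : p.Halved) (F : SimplicialMap (rips X t) (rips Y r))
    {a' b' : Y} (ha : ∀ w, dist a w ≤ dist a b / 2 → dist a' (F.toFun w) < r)
    (hb : ∀ w, dist w b ≤ dist a b / 2 → dist (F.toFun w) b' < r)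
    (haa : IsEdge (rips Y r) a' (F.toFun a)) (hbb : IsEdge (rips Y r) b' (F.toFun b))
    (hab : IsEdge (rips Y r) a' b') :
    Homotopic ((single haa).comp (p.map F)) ((single hab).comp (single hbb)) := by
  obtain ⟨m, p₁, p₂, rfl, h₁, h₂⟩ := hp
  have k₁ := h₁.map F (R := fun w => dist a' w < r) ha
  have k₂ := h₂.map F (R := fun w => dist w b' < r) hb
  refine .of_comp_right (single hbb.symm) ?_
  rw [map_comp_path, ← comp_assoc, comp_assoc, comp_assoc]
  -- Each half collapses to one edge, by coning from `a'` and from `b'`; the triangle on `a'`, the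
  -- image of `m`, and `b'` then closes up the two edges.
  have c₁ := (cone_left k₁).comp (cone_right k₂)
  have c₂ := (Homotopic.triangle
    (isTriangle_rips.2 ⟨k₁.right, isEdge_rips.1 hab, k₂.left⟩)
    (isEdge_rips.2 k₁.right) (isEdge_rips.2 k₂.left) hab)
  have c₃ := (Homotopic.refl (single hab)).comp (single_comp_single_symm hbb.symm)
  rw [comp_nil] at c₃
  rw [comp_assoc] at c₁
  exact (c₁.trans c₂).trans c₃.symm

theorem Halved.map_ripsBonding {t r : Set.Ioi (0 : ℝ)} {a b : X} {p : EdgePath (rips X t) a b}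
    (hp : p.Halved) (h : t ≤ r) (hab : IsEdge (rips X r) a b) :
    Homotopic (p.map (ripsBonding X h)) (single hab) := by
  have hd := isEdge_rips.1 hab
  have hd₀ : 0 ≤ dist a b := dist_nonneg
  have := hp.map_homotopic (ripsBonding X h) (a' := a) (b' := b)
    (fun w hw => lt_of_le_of_lt hw (by linarith)) (fun w hw => lt_of_le_of_lt hw (by linarith))
    (.refl a) (.refl b) hab
  refine .trans (((Homotopic.const (.refl a)).symm.comp (.refl _)).trans this) ?_
  have h₁ := (Homotopic.refl (single hab)).comp (.const (.refl b))
  rw [comp_nil] at h₁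
  exact h₁

end EdgePath

open EdgePath

/-- Repeated bisection; the condition that vertices lie metrically between the ends passes from the
two halves to the whole by the triangle inequality. -/
theorem IsGeodesicSpace.exists_edgePath (hX : IsGeodesicSpace X) (t : Set.Ioi (0 : ℝ)) (x y : X) :
    ∃ p : EdgePath (rips X t) x y, p.Within fun w => dist x w + dist w y ≤ dist x y := by
  obtain ⟨n, hn⟩ : ∃ n : ℕ, dist x y < 2 ^ n * (t : ℝ) := by
    obtain ⟨n, hn⟩ := pow_unbounded_of_one_lt (dist x y / t) one_lt_two
    exact ⟨n, (div_lt_iff₀ t.2).1 hn⟩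
  induction n generalizing x y with
  | zero =>
    refine ⟨single (isEdge_rips.2 (by simpa using hn)), ?_⟩
    simp [single, Within]
  | succ n ih =>
    obtain ⟨m, h₁, h₂⟩ := hX.exists_midpoint x y
    rw [pow_succ] at hn
    obtain ⟨p, hp⟩ := ih x m (by linarith)
    obtain ⟨q, hq⟩ := ih m y (by linarith)
    refine ⟨p.comp q, (hp.mono fun w hw => ?_).comp (hq.mono fun w hw => ?_)⟩
    · have := dist_triangle w m y
      linarith
    · have := dist_triangle x m w
      linarith

theorem IsGeodesicSpace.exists_halved (hX : IsGeodesicSpace X) (t : Set.Ioi (0 : ℝ)) (x y : X) :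
    ∃ p : EdgePath (rips X t) x y, p.Halved := by
  obtain ⟨m, h₁, h₂⟩ := hX.exists_midpoint x y
  obtain ⟨p, hp⟩ := hX.exists_edgePath t x m
  obtain ⟨q, hq⟩ := hX.exists_edgePath t m y
  refine ⟨p.comp q, m, p, q, rfl, hp.mono fun w hw => ?_, hq.mono fun w hw => ?_⟩
  · have : 0 ≤ dist w m := dist_nonneg
    linarith
  · have : 0 ≤ dist m w := dist_nonneg
    linarith

/-! ### Edge inverses of bonding maps and inclusions -/

/-- Subdivision is inverse to the bonding map on edges. -/
def subdivisionInverse {t r : Set.Ioi (0 : ℝ)} (h : t ≤ r)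
    (sub : ∀ a b : X, EdgePath (rips X t) a b) (hsub : ∀ a b, (sub a b).Halved) :
    EdgeInverse (ripsBonding X h) where
  vertex := id
  edge a b _ := sub a b
  unit a := nil a
  unit_natural a b e := by
    have h₁ := (hsub a b).map_ripsBonding le_rfl e
    rw [map_ripsBonding_self] at h₁
    exact h₁
  counit a := nil a
  counit_natural a b e := by
    exact (hsub a b).map_ripsBonding h e

section Sample

variable {S : Set X} {s : ℝ} {t r : Set.Ioi (0 : ℝ)}

/-- A map that moves points by less than `s` to points of `S`, as a simplicial map. -/
def nearbySimplicial (n : X → S) (hn : ∀ x : X, dist x (n x) < s) (hr : (t : ℝ) + 2 * s ≤ r) :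
    SimplicialMap (rips X t) (rips S r) where
  toFun := n
  image_mem σ hσ := by
    have hmem (y : S) := @Finset.mem_image X S (fun a b => Classical.propDecidable (a = b)) n σ y
    obtain ⟨x, hx⟩ := hσ.1
    refine ⟨⟨n x, (hmem _).2 ⟨x, hx, rfl⟩⟩, ?_⟩
    have hs : 0 < s := dist_nonneg.trans_lt (hn x)
    have hd : Metric.diam (σ : Set X) < t := hσ.2
    refine lt_of_le_of_lt (b := Metric.diam (σ : Set X) + 2 * s)
      (Metric.diam_le_of_forall_dist_le (by positivity) ?_) (by linarith)
    intro a ha b hb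
    obtain ⟨a, ha', rfl⟩ := (hmem a).1 (Finset.mem_coe.1 ha)
    obtain ⟨b, hb', rfl⟩ := (hmem b).1 (Finset.mem_coe.1 hb)
    have h₁ : dist a b ≤ Metric.diam (σ : Set X) :=
      Metric.dist_le_diam_of_mem σ.finite_toSet.isBounded ha' hb'
    have h₂ := dist_triangle4 (n a : X) a b (n b)
    rw [dist_comm _ a] at h₂
    have := hn a
    have := hn b
    rw [Subtype.dist_eq]
    linarith

/-- Subdivision followed by a nearby map to `S` is inverse to the inclusion on edges. -/
def sampleInverse (n : X → S) (hn : ∀ x : X, dist x (n x) < s) (hr : (t : ℝ) + 2 * s ≤ r)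
    (sub : ∀ a b : X, EdgePath (rips X t) a b) (hsub : ∀ a b, (sub a b).Halved) :
    EdgeInverse (ripsInclusion S r) := 
  have ht : 0 < (t : ℝ) := t.2
  have hs (x : X) : 0 < s := dist_nonneg.trans_lt (hn x)
  -- As `t > 0`, the assumption `t + 2s ≤ r` gives `s < r / 2`, so the distance is below `r / 2 + s
  -- < r`. This is where control by half the edge length is needed.
  have near {a b w : X} (hab : dist a b < r) (hw : dist a w ≤ dist a b / 2) :
      dist a (n w : X) < r := by
    have := dist_triangle a w (n w)
    have := hn w
    linarith
  have near' {a b w : X} (hab : dist a b < r) (hw : dist w b ≤ dist a b / 2) :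
      dist (n w : X) b < r := by
    rw [dist_comm a b] at hab hw
    rw [dist_comm w b] at hw
    rw [dist_comm]
    exact near hab hw
  have self (a : X) : dist a (n a) < r := by
    have := hn a
    have := hs a
    linarith
  { vertex := n
    edge a b _ := (sub a b).map (nearbySimplicial n hn hr)
    unit a := single (b := n a) (isEdge_rips.2 (self a))
    unit_natural a b e :=
      have hd : dist a b < r := isEdge_rips.1 e
      (hsub (a : X) b).map_homotopic (nearbySimplicial n hn hr)
        (fun _ hw => near hd hw) (fun _ hw => near' hd hw) _ _ e
    counit a := single (isEdge_rips.2 (self a))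
    counit_natural a b e := by
      have h₁ := (hsub a b).map_homotopic
        ((ripsInclusion S r).comp (nearbySimplicial n hn hr)) (a' := a) (b' := b)
        (fun _ hw => near (isEdge_rips.1 e) hw) (fun _ hw => near' (isEdge_rips.1 e) hw)
        (isEdge_rips.2 (self a)) (isEdge_rips.2 (self b)) e
      rw [← map_map] at h₁
      exact h₁ }

end Sample

end Rips

end RipsPersistence

namespace RipsPersistence

/-! ### Bijectivity of bonding maps and inclusions of Rips complexes -/

section Injectivity

variable {X : Type u} [MetricSpace X] {t r : Set.Ioi (0 : ℝ)}

theorem EdgePath.Halved.map_comp_homotopic {a b c : X} {p : EdgePath (rips X t) a b}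
    {q : EdgePath (rips X t) b c} {k : EdgePath (rips X t) a c} (hp : p.Halved) (hq : q.Halved)
    (hk : k.Halved) (h : t ≤ r) (habc : IsTriangle (rips X r) a b c) :
    Homotopic ((p.comp q).map (ripsBonding X h)) (k.map (ripsBonding X h)) := by
  have hab : IsEdge (rips X r) a b := habc.edge (by simp) (by simp)
  have hbc : IsEdge (rips X r) b c := habc.edge (by simp) (by simp)
  have hac : IsEdge (rips X r) a c := habc.edge (by simp) (by simp)
  rw [map_comp_path]
  refine ((hp.map_ripsBonding h hab).comp (hq.map_ripsBonding h hbc)).trans ?_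
  exact (Homotopic.triangle habc hab hbc hac).trans (hk.map_ripsBonding h hac).symm

/-- Every triangle of an open Rips complex lies in one of smaller scale. -/
theorem IsTriangle.exists_lt {a b c : X} (h : IsTriangle (rips X r) a b c) (htr : t < r) :
    ∃ r' : Set.Ioi (0 : ℝ), t ≤ r' ∧ r' < r ∧ IsTriangle (rips X r') a b c := by
  rw [isTriangle_rips] at h
  have hm : max (t : ℝ) (max (dist a b) (max (dist a c) (dist b c))) < r :=
    max_lt htr (max_lt h.1 (max_lt h.2.1 h.2.2))
  obtain ⟨r', h₁, h₂⟩ := exists_between hm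
  simp only [max_lt_iff] at h₁
  exact ⟨⟨r', lt_trans t.2 h₁.1⟩, h₁.1.le, h₂, isTriangle_rips.2 h₁.2⟩

section PiOne

variable (hX : IsGeodesicSpace X) (x : X)

include hX

theorem piOne_ripsBonding_surjective (h : t ≤ r) :
    Function.Surjective (PiOne.map (ripsBonding X h) x) := by
  choose sub hsub using hX.exists_halved t
  exact (subdivisionInverse h sub hsub).piOne_surjective x

theorem piOne_halved_homotopic (h : t ≤ r)
    (hinj : Function.Injective (PiOne.map (ripsBonding X h) x)) {a b c : X}
    {p : EdgePath (rips X t) a b} {q : EdgePath (rips X t) b c} {k : EdgePath (rips X t) a c}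
    (hp : p.Halved) (hq : q.Halved) (hk : k.Halved) (habc : IsTriangle (rips X r) a b c) :
    EdgePath.Homotopic (p.comp q) k := by
  obtain ⟨e, -⟩ := hX.exists_edgePath t x a
  exact PiOne.homotopic_of_map hinj e (hp.map_comp_homotopic hq hk h habc)

/-- Left continuity of open Rips complexes: each triangle at scale `r` lies at some `r' < r`, where
injectivity already makes its subdivided boundary trivial. -/
theorem piOne_ripsBonding_injective_of_lt (h : t < r)
    (hinj : ∀ (r' : Set.Ioi (0 : ℝ)) (h' : t ≤ r'), r' < r →
      Function.Injective (PiOne.map (ripsBonding X h') x)) :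
    Function.Injective (PiOne.map (ripsBonding X h.le) x) := by
  choose sub hsub using hX.exists_halved t
  refine (subdivisionInverse h.le sub hsub).piOne_injective (fun a b c _ _ _ habc => ?_) x
  obtain ⟨r', h₁, h₂, h₃⟩ := habc.exists_lt h
  exact piOne_halved_homotopic hX x h₁ (hinj r' h₁ h₂) (hsub _ _) (hsub _ _) (hsub _ _) h₃

/-- Injectivity of `t → r` contracts the subdivided boundary of a triangle within `Rips(X, t)`, and
the nearby map pushes that contraction into `Rips(S, r)`. The basepoints `x` and `y` are unrelated,
`X` being connected by short edges. -/
theorem piOne_ripsInclusion_bijective {S : Set X} {s : ℝ} (hS : IsDenseSample s S)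
    (hr : (t : ℝ) + 2 * s ≤ r) (h : t ≤ r)
    (hinj : Function.Injective (PiOne.map (ripsBonding X h) x)) (y : S) :
    Function.Bijective (PiOne.map (ripsInclusion S r) y) := by
  choose sub hsub using hX.exists_halved t
  choose n hnS hn using hS
  let I := sampleInverse (t := t) (r := r) (fun x => ⟨n x, hnS x⟩) hn hr sub hsub
  refine ⟨I.piOne_injective (fun a b c _ _ _ habc => ?_) y, I.piOne_surjective y⟩
  have h₁ := (piOne_halved_homotopic hX x h hinj (hsub _ _) (hsub _ _) (hsub _ _) habc).map
    (nearbySimplicial (t := t) (r := r) (fun x => ⟨n x, hnS x⟩) hn hr)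
  rw [EdgePath.map_comp_path] at h₁
  exact h₁

end PiOne

section HOne

variable (hX : IsGeodesicSpace X) (G : Type w) [AddCommGroup G]

include hX

theorem hOne_ripsBonding_surjective (h : t ≤ r) :
    Function.Surjective (HOne.map G (ripsBonding X h)) := by
  choose sub hsub using hX.exists_halved t
  exact (subdivisionInverse h sub hsub).hOne_surjective G

theorem hOne_ripsBonding_injective_of_lt (h : t < r)
    (hinj : ∀ (r' : Set.Ioi (0 : ℝ)) (h' : t ≤ r'), r' < r →
      Function.Injective (HOne.map G (ripsBonding X h'))) :
    Function.Injective (HOne.map G (ripsBonding X h.le)) := by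
  choose sub hsub using hX.exists_halved t
  refine (subdivisionInverse h.le sub hsub).hOne_injective G fun a b c _ _ _ habc g => ?_
  obtain ⟨r', h₁, h₂, h₃⟩ := habc.exists_lt h
  exact HOne.chain_sub_mem_of_map G (hinj r' h₁ h₂)
    ((hsub a b).map_comp_homotopic (hsub b c) (hsub a c) h₁ h₃) g

theorem hOne_ripsInclusion_bijective {S : Set X} {s : ℝ} (hS : IsDenseSample s S)
    (hr : (t : ℝ) + 2 * s ≤ r) (h : t ≤ r)
    (hinj : Function.Injective (HOne.map G (ripsBonding X h))) :
    Function.Bijective (HOne.map G (ripsInclusion S r)) := by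
  choose sub hsub using hX.exists_halved t
  choose n hnS hn using hS
  let N := nearbySimplicial (t := t) (r := r) (fun x => (⟨n x, hnS x⟩ : S)) hn hr
  let I := sampleInverse (t := t) (r := r) (fun x => ⟨n x, hnS x⟩) hn hr sub hsub
  refine ⟨I.hOne_injective G fun a b c _ _ _ habc g => ?_, I.hOne_surjective G⟩
  obtain ⟨z, hz⟩ := HOne.chain_sub_mem_of_map G hinj
    ((hsub a b).map_comp_homotopic (hsub b c) (hsub a c) h habc) g
  refine ⟨Finsupp.mapDomain (Triangle.map N) z, ?_⟩
  rw [← chainMap_boundaryTwo, hz, map_sub, EdgePath.chainMap_chain, EdgePath.chainMap_chain,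
    EdgePath.map_comp_path]
  rfl

end HOne

end Injectivity

/-! ### Persistences with epimorphic bonding maps -/

section Persistence

variable {C : Type v} [Category.{w} C] {F : Set.Ioi (0 : ℝ) ⥤ C} {a b c : Set.Ioi (0 : ℝ)}

theorem isIso_map_of_eq (h : a = b) : IsIso (F.map (homOfLE h.le)) := by
  subst h
  exact (F.map_id a).symm ▸ inferInstance

theorem isIso_map_trans (h : a ≤ b) (h' : b ≤ c) (hab : IsIso (F.map (homOfLE h)))
    (hbc : IsIso (F.map (homOfLE h'))) : IsIso (F.map (homOfLE (h.trans h'))) := by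
  rw [← homOfLE_comp h h', F.map_comp]
  infer_instance

/-- A first factor of an isomorphism is a split monomorphism, and an epic one is invertible. -/
theorem isIso_map_of_le (h : a ≤ b) (h' : b ≤ c) [Epi (F.map (homOfLE h))]
    (hac : IsIso (F.map (homOfLE (h.trans h')))) : IsIso (F.map (homOfLE h)) := by
  rw [← homOfLE_comp h h', F.map_comp] at hac
  have : IsSplitMono (F.map (homOfLE h)) :=
    ⟨⟨F.map (homOfLE h') ≫ inv (F.map (homOfLE h) ≫ F.map (homOfLE h')), by
      rw [← Category.assoc, IsIso.hom_inv_id]⟩⟩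
  exact isIso_of_epi_of_isSplitMono _

/-- Take the supremum `m` of the scales up to `b` reached from `a` by an isomorphism. Since `m` is
not left critical it is itself reached; since it is not right critical, `m < b` would let one go
further. -/
theorem isIso_map_of_not_isCritical (hF : ∀ (p q : Set.Ioi (0 : ℝ)) (h : p ≤ q),
      Epi (F.map (homOfLE h))) (h : a ≤ b) (hc : ∀ c, a ≤ c → c ≤ b → ¬ IsCritical F c) :
    IsIso (F.map (homOfLE h)) := by
  let T : Set ℝ := {t | ∃ c : Set.Ioi (0 : ℝ), (c : ℝ) = t ∧ c ≤ b ∧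
    ∃ hac : a ≤ c, IsIso (F.map (homOfLE hac))}
  have haT : (a : ℝ) ∈ T := ⟨a, rfl, h, le_rfl, isIso_map_of_eq rfl⟩
  have hT : BddAbove T := ⟨b, by rintro _ ⟨c, rfl, hcb, -⟩; exact hcb⟩
  have ham : (a : ℝ) ≤ sSup T := le_csSup hT haT
  let m : Set.Ioi (0 : ℝ) := ⟨sSup T, lt_of_lt_of_le a.2 ham⟩
  have hab : a ≤ m := ham
  have hmb : m ≤ b := csSup_le (a := (b : ℝ)) ⟨_, haT⟩ (by rintro _ ⟨c, rfl, hcb, -⟩; exact hcb)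
  have hm : ¬ IsCritical F m := hc m hab hmb
  simp only [IsCritical, IsLeftCritical, IsRightCritical, not_or, not_exists, not_and,
    not_forall, not_not] at hm
  have ham : IsIso (F.map (homOfLE hab)) := by
    rcases hab.eq_or_lt with he | hlt
    · exact isIso_map_of_eq he
    -- The choice `δ = m - a` forces `a < c`. A member of `T` beyond `c` then makes `a → c` an
    -- isomorphism.
    · obtain ⟨c, hcm, hc, hi⟩ := hm.1 ((m : ℝ) - a) (sub_pos.2 hlt)
      rw [sub_sub_cancel] at hc
      have hac : a ≤ c := le_of_lt hc
      obtain ⟨_, ⟨d, rfl, -, had, hd⟩, hcd⟩ := exists_lt_of_lt_csSup ⟨_, haT⟩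
        (show (c : ℝ) < sSup T from hcm)
      have := hF a c hac
      exact isIso_map_trans hac hcm.le (isIso_map_of_le hac (le_of_lt hcd) hd) hi
  rcases hmb.eq_or_lt with he | hlt
  · exact isIso_map_trans hab hmb ham (isIso_map_of_eq he)
  · exfalso
    obtain ⟨d, hmd, hi⟩ := hm.2
    have hm' : m < min d b := lt_min hmd hlt
    have := hF m (min d b) hm'.le
    have := isIso_map_trans hab hm'.le ham (isIso_map_of_le hm'.le (min_le_left d b) hi)
    exact absurd (le_csSup hT ⟨min d b, rfl, min_le_right d b, hab.trans hm'.le, this⟩)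
      (not_le_of_gt hm')

variable {E : Set.Ioi (0 : ℝ) ⥤ C} (μ : E ⟶ F) {s : ℝ}

theorem isIso_app_and_isIso_map (hF : ∀ (p q : Set.Ioi (0 : ℝ)) (h : p ≤ q),
      Epi (F.map (homOfLE h))) (hs : 0 ≤ s)
    (hμ : ∀ (t r : Set.Ioi (0 : ℝ)) (h : t ≤ r), (t : ℝ) + 2 * s ≤ r →
      IsIso (F.map (homOfLE h)) → IsIso (μ.app r))
    {p q : ℝ} (hp : 0 < p)
    (hc : ∀ c : Set.Ioi (0 : ℝ), (c : ℝ) ∈ Set.Ioc p (p + 2 * s + q) → ¬ IsCritical F c) :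
    (∀ r : Set.Ioi (0 : ℝ), (r : ℝ) ∈ Set.Ioc (p + 2 * s) (p + 2 * s + q) → IsIso (μ.app r)) ∧
      (∀ (p' q' : Set.Ioi (0 : ℝ)) (h : p' ≤ q'),
        Set.Icc (p' : ℝ) (q' : ℝ) ⊆ Set.Ioc (p + 2 * s) (p + 2 * s + q) →
        IsIso (E.map (homOfLE h))) := by
  have key : ∀ r : Set.Ioi (0 : ℝ), (r : ℝ) ∈ Set.Ioc (p + 2 * s) (p + 2 * s + q) →
      IsIso (μ.app r) := by
    intro r hr
    have ht : p < (r : ℝ) - 2 * s := by linarith [hr.1]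
    let t : Set.Ioi (0 : ℝ) := ⟨r - 2 * s, hp.trans ht⟩
    have htr : t ≤ r := sub_le_self (r : ℝ) (by positivity)
    exact hμ t r htr (sub_add_cancel (r : ℝ) (2 * s)).le (isIso_map_of_not_isCritical hF htr
      fun c h₁ h₂ => hc c ⟨ht.trans_le h₁, le_trans h₂ hr.2⟩)
  refine ⟨key, fun p' q' h hpq => ?_⟩
  have h₁ := key p' (hpq ⟨le_rfl, h⟩)
  have h₂ := key q' (hpq ⟨h, le_rfl⟩)
  have hF' : IsIso (F.map (homOfLE h)) := by
    have hp' := hpq ⟨le_rfl, h⟩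
    have hq' := hpq (a := (q' : ℝ)) ⟨h, le_rfl⟩
    exact isIso_map_of_not_isCritical hF h fun c hc₁ hc₂ => hc c
      ⟨by linarith [hp'.1, show (p' : ℝ) ≤ c from hc₁], le_trans hc₂ hq'.2⟩
  have hn := μ.naturality (homOfLE h)
  -- Three sides of the naturality square are isomorphisms, hence so is the fourth.
  have : IsIso (E.map (homOfLE h) ≫ μ.app q') := by
    rw [hn]
    infer_instance
  exact IsIso.of_isIso_comp_right _ (μ.app q')

/-- The isomorphism is the inverse of `μ` restricted to the stable set, so compatibility with
bonding maps is automatic. -/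
theorem nonempty_restrict_iso (hF : ∀ (p q : Set.Ioi (0 : ℝ)) (h : p ≤ q),
      Epi (F.map (homOfLE h)))
    (hcont : ∀ (t r : Set.Ioi (0 : ℝ)) (h : t < r),
      (∀ (r' : Set.Ioi (0 : ℝ)) (h' : t ≤ r'), r' < r → IsIso (F.map (homOfLE h'))) →
      IsIso (F.map (homOfLE h.le)))
    {s' : ℝ} (hs' : 0 < s') (hss : s' < s)
    (hμ : ∀ (t r : Set.Ioi (0 : ℝ)) (h : t ≤ r), (t : ℝ) + 2 * s' ≤ r →
      IsIso (F.map (homOfLE h)) → IsIso (μ.app r)) :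
    Nonempty (restrict (stableSet F s) F ≅ restrict (stableSet F s) E) := by
  have key (r : stableSet F s) : IsIso (μ.app r) := by
    obtain ⟨r, hr, hc⟩ := r
    let t : Set.Ioi (0 : ℝ) := ⟨r - 2 * s', by rw [Set.mem_Ioi]; linarith⟩
    have htr : t < r := sub_lt_self (r : ℝ) (by positivity)
    -- The stable set may contain critical values, so `r` itself is reached only through `hcont`. A
    -- critical `c` in `[r - 2s', r)` would satisfy `c < r < c + 2s`, which is excluded.
    refine hμ t r htr.le (sub_add_cancel (r : ℝ) (2 * s')).le (hcont t r htr fun r' h' hr' => ?_)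
    refine isIso_map_of_not_isCritical hF h' fun c h₁ h₂ hcrit => hc c hcrit ⟨?_, ?_⟩
    · exact lt_of_le_of_lt h₂ hr'
    · have : (r : ℝ) - 2 * s' ≤ c := h₁
      linarith
  let α : restrict (stableSet F s) E ⟶ restrict (stableSet F s) F :=
    Functor.whiskerLeft (Subtype.mono_coe (fun r => r ∈ stableSet F s)).functor μ
  have (r : stableSet F s) : IsIso (α.app r) := key r
  have : IsIso α := NatIso.isIso_of_isIso_app α
  exact ⟨(asIso α).symm⟩

end Persistence

/-- In a compact space a dense sample is dense with a smaller constant. -/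
theorem IsDenseSample.exists_lt {X : Type u} [MetricSpace X] [CompactSpace X] {s : ℝ} (hs : 0 < s)
    {S : Set X} (hS : IsDenseSample s S) : ∃ s', 0 < s' ∧ s' < s ∧ IsDenseSample s' S := by
  rcases isEmpty_or_nonempty X with hX | hX
  · exact ⟨s / 2, by positivity, by linarith, fun x => (hX.false x).elim⟩
  obtain ⟨x, -, hx⟩ := isCompact_univ.exists_isMaxOn Set.univ_nonempty
    (Metric.continuous_infDist_pt S).continuousOn
  have hSne : S.Nonempty := let ⟨y, hy, _⟩ := hS x; ⟨y, hy⟩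
  have hlt : Metric.infDist x S < s := (Metric.infDist_lt_iff hSne).2 (hS x)
  obtain ⟨s', h₁, h₂⟩ := exists_between hlt
  exact ⟨s', Metric.infDist_nonneg.trans_lt h₁, h₂, fun y =>
    (Metric.infDist_lt_iff hSne).1 (lt_of_le_of_lt (hx (Set.mem_univ y)) h₁)⟩

/-! ### Translation to the persistence functors -/

section Functors

variable {X : Type u} [MetricSpace X] (hX : IsGeodesicSpace X) (x : X) (G : Type w)
  [AddCommGroup G]

theorem isIso_piOnePersistence_map_iff {p q : Set.Ioi (0 : ℝ)} (h : p ≤ q) :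
    IsIso ((piOnePersistence X x).map (homOfLE h)) ↔
      Function.Bijective (PiOne.map (ripsBonding X h) x) :=
  ConcreteCategory.isIso_iff_bijective _

theorem isIso_hOnePersistence_map_iff {p q : Set.Ioi (0 : ℝ)} (h : p ≤ q) :
    IsIso ((hOnePersistence X G).map (homOfLE h)) ↔
      Function.Bijective (HOne.map G (ripsBonding X h)) :=
  ConcreteCategory.isIso_iff_bijective _

include hX

theorem epi_piOnePersistence_map (p q : Set.Ioi (0 : ℝ)) (h : p ≤ q) :
    Epi ((piOnePersistence X x).map (homOfLE h)) :=
  ConcreteCategory.epi_of_surjective _ (piOne_ripsBonding_surjective hX x h)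

theorem epi_hOnePersistence_map (p q : Set.Ioi (0 : ℝ)) (h : p ≤ q) :
    Epi ((hOnePersistence X G).map (homOfLE h)) :=
  ConcreteCategory.epi_of_surjective _ (hOne_ripsBonding_surjective hX G h)

theorem isIso_piOnePersistence_map_of_lt (t r : Set.Ioi (0 : ℝ)) (h : t < r)
    (hi : ∀ (r' : Set.Ioi (0 : ℝ)) (h' : t ≤ r'), r' < r →
      IsIso ((piOnePersistence X x).map (homOfLE h'))) :
    IsIso ((piOnePersistence X x).map (homOfLE h.le)) :=
  (isIso_piOnePersistence_map_iff x h.le).2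
    ⟨piOne_ripsBonding_injective_of_lt hX x h fun r' h' hr' =>
      ((isIso_piOnePersistence_map_iff x h').1 (hi r' h' hr')).1,
    piOne_ripsBonding_surjective hX x h.le⟩

theorem isIso_hOnePersistence_map_of_lt (t r : Set.Ioi (0 : ℝ)) (h : t < r)
    (hi : ∀ (r' : Set.Ioi (0 : ℝ)) (h' : t ≤ r'), r' < r →
      IsIso ((hOnePersistence X G).map (homOfLE h'))) :
    IsIso ((hOnePersistence X G).map (homOfLE h.le)) :=
  (isIso_hOnePersistence_map_iff G h.le).2
    ⟨hOne_ripsBonding_injective_of_lt hX G h fun r' h' hr' =>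
      ((isIso_hOnePersistence_map_iff G h').1 (hi r' h' hr')).1,
    hOne_ripsBonding_surjective hX G h.le⟩

variable {s : ℝ} {S : Set X} (hS : IsDenseSample s S)

include hS

theorem isIso_piOneMu_app (hx : x ∈ S) (t r : Set.Ioi (0 : ℝ)) (h : t ≤ r)
    (hr : (t : ℝ) + 2 * s ≤ r) (hi : IsIso ((piOnePersistence X x).map (homOfLE h))) :
    IsIso ((piOneMu S x hx).app r) :=
  (ConcreteCategory.isIso_iff_bijective _).2 (piOne_ripsInclusion_bijective hX x hS hr h
    ((isIso_piOnePersistence_map_iff x h).1 hi).1 ⟨x, hx⟩)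

theorem isIso_hOneMu_app (t r : Set.Ioi (0 : ℝ)) (h : t ≤ r)
    (hr : (t : ℝ) + 2 * s ≤ r) (hi : IsIso ((hOnePersistence X G).map (homOfLE h))) :
    IsIso ((hOneMu S G).app r) :=
  (ConcreteCategory.isIso_iff_bijective _).2 (hOne_ripsInclusion_bijective hX G hS hr h
    ((isIso_hOnePersistence_map_iff G h).1 hi).1)

end Functors

end RipsPersistence

theorem mainTheorem8 {X : Type u} [MetricSpace X] (hX : RipsPersistence.IsGeodesicSpace X)
    (x₀ : X) (G : Type v) [AddCommGroup G] (s : ℝ) (hs : 0 < s) (S : Set X)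
    (hS : RipsPersistence.IsDenseSample s S) (hx₀ : x₀ ∈ S) :
    -- no critical values of the `π₁`-persistence of `X` on `(p, p + 2s + q]`
    (∀ p q : ℝ, 0 < p → 0 ≤ q →
      (∀ c : Set.Ioi (0 : ℝ), (c : ℝ) ∈ Set.Ioc p (p + 2 * s + q) →
        ¬ RipsPersistence.IsCritical (RipsPersistence.piOnePersistence X x₀) c) →
      (∀ r : Set.Ioi (0 : ℝ), (r : ℝ) ∈ Set.Ioc (p + 2 * s) (p + 2 * s + q) →
        IsIso ((RipsPersistence.piOneMu S x₀ hx₀).app r)) ∧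
      (∀ (p' q' : Set.Ioi (0 : ℝ)) (h : p' ≤ q'),
        Set.Icc (p' : ℝ) (q' : ℝ) ⊆ Set.Ioc (p + 2 * s) (p + 2 * s + q) →
        IsIso ((RipsPersistence.piOnePersistence S ⟨x₀, hx₀⟩).map (homOfLE h)))) ∧
    -- no critical values of the `H₁(_; G)`-persistence of `X` on `(p, p + 2s + q]`
    (∀ p q : ℝ, 0 < p → 0 ≤ q →
      (∀ c : Set.Ioi (0 : ℝ), (c : ℝ) ∈ Set.Ioc p (p + 2 * s + q) →
        ¬ RipsPersistence.IsCritical (RipsPersistence.hOnePersistence X G) c) →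
      (∀ r : Set.Ioi (0 : ℝ), (r : ℝ) ∈ Set.Ioc (p + 2 * s) (p + 2 * s + q) →
        IsIso ((RipsPersistence.hOneMu S G).app r)) ∧
      (∀ (p' q' : Set.Ioi (0 : ℝ)) (h : p' ≤ q'),
        Set.Icc (p' : ℝ) (q' : ℝ) ⊆ Set.Ioc (p + 2 * s) (p + 2 * s + q) →
        IsIso ((RipsPersistence.hOnePersistence S G).map (homOfLE h)))) ∧
    -- the two persistences agree away from the intervals `(c, c + 2s)`
    (CompactSpace X →
      Nonempty
        (RipsPersistence.restrict
            (RipsPersistence.stableSet (RipsPersistence.piOnePersistence X x₀) s)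
            (RipsPersistence.piOnePersistence X x₀) ≅
          RipsPersistence.restrict
            (RipsPersistence.stableSet (RipsPersistence.piOnePersistence X x₀) s)
            (RipsPersistence.piOnePersistence S ⟨x₀, hx₀⟩)) ∧
      Nonempty
        (RipsPersistence.restrict
            (RipsPersistence.stableSet (RipsPersistence.hOnePersistence X G) s)
            (RipsPersistence.hOnePersistence X G) ≅
          RipsPersistence.restrict
            (RipsPersistence.stableSet (RipsPersistence.hOnePersistence X G) s)
            (RipsPersistence.hOnePersistence S G))) := by
  open RipsPersistence in
  refine ⟨fun p q hp _ hc => ?_, fun p q hp _ hc => ?_, fun hK => ?_⟩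
  · exact isIso_app_and_isIso_map (piOneMu S x₀ hx₀) (epi_piOnePersistence_map hX x₀) hs.le
      (isIso_piOneMu_app hX x₀ hS hx₀) hp hc
  · exact isIso_app_and_isIso_map (hOneMu S G) (epi_hOnePersistence_map hX G) hs.le
      (isIso_hOneMu_app hX G hS) hp hc
  -- A strictly smaller constant is needed because `r = c + 2s` is allowed: `r - 2s` would then be
  -- the critical value `c`.
  · obtain ⟨s', hs', hss, hS'⟩ := hS.exists_lt hs
    exact ⟨nonempty_restrict_iso (piOneMu S x₀ hx₀) (epi_piOnePersistence_map hX x₀)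
        (isIso_piOnePersistence_map_of_lt hX x₀) hs' hss (isIso_piOneMu_app hX x₀ hS' hx₀),
      nonempty_restrict_iso (hOneMu S G) (epi_hOnePersistence_map hX G)
        (isIso_hOnePersistence_map_of_lt hX G) hs' hss (isIso_hOneMu_app hX G hS')⟩
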